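/- Time is slotted, with slots $t=1,2,\dots$. In each slot, independently, a source symbol arrives with probability $q\in(0,1]$. The successive symbols $X_1,X_2,\dots$ are i.i.d. with PMF $P_X$ on a finite alphabet $\mathcal X$ and are independent of the arrivals; each symbol is time-stamped with its arrival time. A prefix-free binary code $\mathcal E:\mathcal X\to\{0,1\}^*$ is given, $L=|\mathcal E(X)|$ denotes the codeword length of a symbol $X\sim P_X$, and $P_L$ is its distribution. On arrival of $X_k$ its codeword $\mathcal E(X_k)$ is appended to an initially empty FIFO buffer of infinite capacity; in each time unit $(t,t+1]$ the buffer outputs the first bit of its content at time $t$, which is received at time $t+1$ (if the buffer is empty at time $t$, the decoder is told so and receives no bit). A symbol is decoded as soon as its whole codeword and those of all earlier symbols have been received. For real $t\ge 0$ let $u(t)$ be the time stamp of the most recent symbol decoded by time $t$, with $u(t)=-\Delta_0$ for a fixed $\Delta_0\ge 0$ before the first symbol is decoded, and let $\Delta(t)=t-u(t)$ be the age. The age grows with slope one except for downward jumps; the $k$-th peak $\Delta_k$ is the left limit of $\Delta$ at its $k$-th downward jump. If the system is stable, that is, $\mathbb E[L]<1/q$, then almost surely there are infinitely many peaks and the average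 peak age of information exists and is given by $$\Delta^{P}=\lim_{K\to\infty}\frac1K\sum_{k=1}^{K}\Delta_k=\frac{\mathbb E[L^2]-\mathbb E[L]}{2\,(1/q-\mathbb E[L])}+\mathbb E[L]+\frac1q .$$ -/

import Mathlib

/-!
Sample-path description of the streaming source coding system.

Time is slotted. `a t` tells whether a source symbol arrives at the integer time `t` (slots start
at `t = 1`), `x k` is the `(k+1)`-st source symbol, and `c` is the code.
-/

namespace StreamCoding

/-- A binary code is prefix-free: no codeword is a prefix of the codeword of another symbol. -/
def PrefixFree {𝒳 : Type*} (c : 𝒳 → List Bool) : Prop :=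
  ∀ x y, c x <+: c y → x = y

/-- The moment `E[L ^ m]` of the codeword length `L = l(X)`, where `X` has PMF `P`. -/
noncomputable def lengthMoment {𝒳 : Type*} [Fintype 𝒳] (P : PMF 𝒳) (c : 𝒳 → List Bool)
    (m : ℕ) : ℝ :=
  ∑ x, (P x).toReal * ((c x).length : ℝ) ^ m

/-- A symbol arrives at time `t`. -/
def Arrival (a : ℕ → Bool) (t : ℕ) : Prop := 1 ≤ t ∧ a t = true

instance (a : ℕ → Bool) : DecidablePred (Arrival a) :=
  fun t => inferInstanceAs (Decidable (1 ≤ t ∧ a t = true))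

/-- `N(t)`: the number of symbols observed by the encoder by time `t` (inclusive). -/
def numArrivals (a : ℕ → Bool) (t : ℕ) : ℕ := Nat.count (Arrival a) (t + 1)

/-- The time stamp of the symbol `x k`. -/
noncomputable def timeStamp (a : ℕ → Bool) (k : ℕ) : ℕ := Nat.nth (Arrival a) k

/-- The concatenated codewords of the first `k` symbols. -/
def encodeFirst {𝒳 : Type*} (c : 𝒳 → List Bool) (x : ℕ → 𝒳) (k : ℕ) : List Bool :=
  ((List.range k).map fun i => c (x i)).flatten

/-- Content of the FIFO buffer at time `t`, just after the codeword of the symbol arriving at `t`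
(if there is one) has been appended. During `(t, t + 1]` the buffer outputs its first bit. -/
def buffer {𝒳 : Type*} (c : 𝒳 → List Bool) (a : ℕ → Bool) (x : ℕ → 𝒳) : ℕ → List Bool
  | 0 => []
  | t + 1 => (buffer c a x t).tail ++
      (if Arrival a (t + 1) then c (x (numArrivals a t)) else [])

/-- The bits that the decoder has received by time `t`. In a slot in which the buffer is empty no
bit is sent. -/
def received {𝒳 : Type*} (c : 𝒳 → List Bool) (a : ℕ → Bool) (x : ℕ → 𝒳) : ℕ → List Bool
  | 0 => []
  | t + 1 => received c a x t ++ (buffer c a x t).take 1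

/-- The number of symbols decoded by time `t`: the largest number `k` of arrived symbols such that
the codewords of the first `k` symbols have been received completely. -/
def numDecoded {𝒳 : Type*} (c : 𝒳 → List Bool) (a : ℕ → Bool) (x : ℕ → 𝒳) (t : ℕ) : ℕ :=
  Nat.findGreatest (fun k => encodeFirst c x k <+: received c a x t) (numArrivals a t)

/-- `u(t)`: the time stamp of the most recent symbol decoded by the (real) time `t`; before the
first symbol is decoded it is `-Δ₀`, so that the age starts from `Δ₀` at time `0`. -/
noncomputable def lastStamp {𝒳 : Type*} (Δ₀ : ℝ) (c : 𝒳 → List Bool) (a : ℕ → Bool)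
    (x : ℕ → 𝒳) (t : ℝ) : ℝ :=
  if numDecoded c a x ⌊t⌋₊ = 0 then -Δ₀
  else (timeStamp a (numDecoded c a x ⌊t⌋₊ - 1) : ℝ)

/-- The age process `Δ(t) = t - u(t)`. -/
noncomputable def age {𝒳 : Type*} (Δ₀ : ℝ) (c : 𝒳 → List Bool) (a : ℕ → Bool)
    (x : ℕ → 𝒳) (t : ℝ) : ℝ :=
  t - lastStamp Δ₀ c a x t

/-- The age process peaks at time `n`: it drops there, from its left limit to a smaller value.
(The age grows with slope one between integer times, so that it drops only at integer times.) -/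
def IsPeakTime {𝒳 : Type*} (Δ₀ : ℝ) (c : 𝒳 → List Bool) (a : ℕ → Bool) (x : ℕ → 𝒳)
    (n : ℕ) : Prop :=
  age Δ₀ c a x n < Function.leftLim (age Δ₀ c a x) n

/-- The value of the `(k+1)`-st peak of the age process: its left limit at the `(k+1)`-st
peak time. -/
noncomputable def peakAge {𝒳 : Type*} (Δ₀ : ℝ) (c : 𝒳 → List Bool) (a : ℕ → Bool)
    (x : ℕ → 𝒳) (k : ℕ) : ℝ :=
  Function.leftLim (age Δ₀ c a x) (Nat.nth (IsPeakTime Δ₀ c a x) k : ℕ)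

end StreamCoding

open Filter Topology MeasureTheory ProbabilityTheory

namespace StreamCoding

/-! ### Deterministic analysis of a sample path: decoding times, peaks and their telescoping sum. -/

section SamplePath

variable {𝒳 : Type*} (c : 𝒳 → List Bool) (a : ℕ → Bool) (x : ℕ → 𝒳)

/-! Let `S k` be the time stamps and `W k` the buffer length just after the codeword of the `k`-th
symbol is appended. The buffer is FIFO and drains one bit per time unit, so that symbol is decoded
at `D k = S k + W k`. The age drops exactly at the times `D k`, and the peak there is `D k - S (k -
1) = W k + (S k - S (k - 1))`. Summing telescopes (`sum_peakAge`), so the average peak is the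
average of `W k` over arrivals plus the mean interarrival time `1 / q`; only long-run rates are
needed (`tendsto_average_peakAge`).

For these, let `U t` be the buffer length at time `t` minus the bit about to be sent. It obeys `U (t
+ 1) = max (U t + ℓ t - 1) 0`, where `ℓ t` is the number of bits arriving at time `t + 1`. The marks
(symbol or no symbol) are i.i.d. and each is independent of the past (`measure_history_mark`),
although the index of an arriving symbol is random. The quantity `U ^ 2 + U` increases by exactly `2
U (ℓ - 1) + ℓ (ℓ - 1)` (`backlog_sq_add`). Once `U ^ 2 / T → 0` and fluctuations average out, this
forces the time average of `U` to be `E[ℓ (ℓ - 1)] / (2 (1 - E[ℓ]))`, with `E[ℓ] = q E[L]` and `E[ℓ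
(ℓ - 1)] = q (E[L ^ 2] - E[L])`. An arrival finds this average backlog, by independence, and adds
its own codeword, of mean `E[L]`.

No stationary distribution is used: an exponential drift bound gives uniform moments of `U`
(`exists_integral_pow_backlog_le`), hence `U t = o(√t)` almost surely, and a strong law for
orthogonal increments handles the fluctuations (`ae_tendsto_average_of_orthogonal`). -/

theorem numArrivals_zero : numArrivals a 0 = 0 := by
  simp [numArrivals, Nat.count_succ, Arrival]

theorem numArrivals_succ (t : ℕ) :
    numArrivals a (t + 1) = numArrivals a t + if Arrival a (t + 1) then 1 else 0 := by
  rw [numArrivals, Nat.count_succ]; rfl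

theorem encodeFirst_succ (k : ℕ) : encodeFirst c x (k + 1) = encodeFirst c x k ++ c (x k) := by
  simp [encodeFirst, List.range_succ]

theorem encodeFirst_prefix {j k : ℕ} (h : j ≤ k) : encodeFirst c x j <+: encodeFirst c x k := by
  induction k, h using Nat.le_induction with
  | base => exact List.prefix_rfl
  | succ k _ ih => exact ih.trans (by rw [encodeFirst_succ]; exact List.prefix_append _ _)

/-- Every bit of an arrived codeword is either already received or still in the buffer. -/
theorem received_append_buffer (t : ℕ) :
    received c a x t ++ buffer c a x t = encodeFirst c x (numArrivals a t) := by
  induction t with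
  | zero => simp [received, buffer, numArrivals_zero, encodeFirst]
  | succ t ih =>
    have hb : (buffer c a x t).take 1 ++ (buffer c a x t).tail = buffer c a x t := by
      cases buffer c a x t <;> simp
    rw [received, buffer, List.append_assoc, ← List.append_assoc (List.take 1 _), hb,
      ← List.append_assoc, ih, numArrivals_succ]
    split_ifs
    · rw [encodeFirst_succ]
    · simp

theorem length_received_succ (t : ℕ) : (received c a x (t + 1)).length =
    (received c a x t).length + min 1 (buffer c a x t).length := by
  simp [received]

theorem length_received_mono : Monotone fun t => (received c a x t).length :=
  monotone_nat_of_le_succ fun t => by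
    rw [length_received_succ]; exact Nat.le_add_right _ _

theorem length_buffer_succ (t : ℕ) : (buffer c a x (t + 1)).length =
    (buffer c a x t).length - 1 +
      if Arrival a (t + 1) then (c (x (numArrivals a t))).length else 0 := by
  rw [buffer]; split_ifs <;> simp

theorem le_length_buffer_add (s j : ℕ) :
    (buffer c a x s).length ≤ (buffer c a x (s + j)).length + j := by
  induction j with
  | zero => simp
  | succ j ih =>
    have := length_buffer_succ c a x (s + j)
    rw [← add_assoc s]; omega

/-- The bits present in the buffer at time `s` leave it at one bit per time unit. -/
theorem length_received_add {s j : ℕ} (h : j ≤ (buffer c a x s).length) :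
    (received c a x (s + j)).length = (received c a x s).length + j := by
  induction j with
  | zero => simp
  | succ j ih =>
    have := le_length_buffer_add c a x s j
    rw [← add_assoc, length_received_succ, ih (by omega)]; omega

theorem encodeFirst_prefix_received_iff {k t : ℕ} (hk : k ≤ numArrivals a t) :
    encodeFirst c x k <+: received c a x t ↔
      (encodeFirst c x k).length ≤ (received c a x t).length := by
  refine ⟨List.IsPrefix.length_le, fun h => ?_⟩
  refine List.prefix_of_prefix_length_le (encodeFirst_prefix c x hk) ?_ h
  rw [← received_append_buffer c a x t]; exact List.prefix_append _ _

theorem lt_numDecoded_iff {k t : ℕ} : k < numDecoded c a x t ↔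
    k < numArrivals a t ∧ (encodeFirst c x (k + 1)).length ≤ (received c a x t).length := by
  constructor
  · intro h
    have h1 : numDecoded c a x t ≤ numArrivals a t := Nat.findGreatest_le _
    have h2 : encodeFirst c x (numDecoded c a x t) <+: received c a x t :=
      Nat.findGreatest_spec (P := fun k => encodeFirst c x k <+: received c a x t) (m := 0)
        (Nat.zero_le _) (by simp [encodeFirst])
    exact ⟨h.trans_le h1, (encodeFirst_prefix c x h).length_le.trans h2.length_le⟩
  · rintro ⟨h1, h2⟩
    exact Nat.le_findGreatest (P := fun k => encodeFirst c x k <+: received c a x t) h1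
      ((encodeFirst_prefix_received_iff c a x h1).2 h2)

/-- The time at which the symbol `x k` is decoded. -/
noncomputable def decodeTime (k : ℕ) : ℕ :=
  timeStamp a k + (buffer c a x (timeStamp a k)).length

variable {a}

theorem numArrivals_timeStamp (ha : {t | Arrival a t}.Infinite)
    (k : ℕ) : numArrivals a (timeStamp a k) = k + 1 :=
  Nat.count_nth_succ_of_infinite ha k

theorem lt_numArrivals_iff (ha : {t | Arrival a t}.Infinite)
    {k t : ℕ} : k < numArrivals a t ↔ timeStamp a k ≤ t := by
  have := Nat.lt_nth_iff_count_lt (p := Arrival a) ha (a := t) (b := k)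
  rw [numArrivals, timeStamp, ← Nat.lt_succ_iff (n := t)]
  have h2 := Nat.count_le_iff_le_nth (p := Arrival a) ha (a := t + 1) (b := k)
  omega

theorem length_received_decodeTime (ha : {t | Arrival a t}.Infinite) (k : ℕ) :
    (received c a x (decodeTime c a x k)).length = (encodeFirst c x (k + 1)).length := by
  rw [decodeTime, length_received_add c a x le_rfl, ← numArrivals_timeStamp ha k,
    ← received_append_buffer c a x, List.length_append]

/-- From the arrival of `x k` until `decodeTime`, one bit is received in every time unit, so the
required number of bits is reached at that time and not earlier. -/
theorem lt_numDecoded_iff_decodeTime_le (ha : {t | Arrival a t}.Infinite) {k t : ℕ} :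
    k < numDecoded c a x t ↔ decodeTime c a x k ≤ t := by
  rw [lt_numDecoded_iff, lt_numArrivals_iff ha]
  constructor
  · rintro ⟨h1, h2⟩
    by_contra! h3
    obtain ⟨j, rfl⟩ := Nat.exists_eq_add_of_le h1
    have h4 := length_received_decodeTime c x ha k
    rw [decodeTime] at h3 h4
    rw [length_received_add c a x le_rfl] at h4
    rw [length_received_add c a x (by omega)] at h2
    omega
  · intro h
    refine ⟨(Nat.le_add_right _ _).trans h, ?_⟩
    rw [← length_received_decodeTime c x ha k]
    exact length_received_mono c a x h

theorem timeStamp_strictMono (ha : {t | Arrival a t}.Infinite)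
    : StrictMono (timeStamp a) := Nat.nth_strictMono ha

theorem arrival_timeStamp (ha : {t | Arrival a t}.Infinite)
    (k : ℕ) : Arrival a (timeStamp a k) := Nat.nth_mem_of_infinite ha k

/-- With nonempty codewords each further symbol needs strictly more received bits; with empty ones
every symbol is decoded on arrival. Distinct decoding times make peaks correspond one to one to
symbols. -/
theorem decodeTime_strictMono (ha : {t | Arrival a t}.Infinite)
    (hc : (∀ y, c y = []) ∨ ∀ y, c y ≠ []) :
    StrictMono (decodeTime c a x) := by
  refine strictMono_nat_of_lt_succ fun k => ?_
  rcases hc with hc | hc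
  · have hb : ∀ t, (buffer c a x t).length = 0 := by
      intro t
      induction t with
      | zero => rfl
      | succ t ih => rw [length_buffer_succ, ih]; simp [hc]
    simpa [decodeTime, hb] using timeStamp_strictMono ha k.lt_succ_self
  · by_contra! h
    have h1 := length_received_mono c a x h
    simp only [length_received_decodeTime c x ha] at h1
    rw [encodeFirst_succ c x (k + 1), List.length_append] at h1
    have := List.length_pos_iff.2 (hc (x (k + 1)))
    omega

theorem numDecoded_eq_of_decodeTime (ha : {t | Arrival a t}.Infinite)
    (hc : (∀ y, c y = []) ∨ ∀ y, c y ≠ []) {t k : ℕ}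
    (h : t + 1 = decodeTime c a x k) : numDecoded c a x t = k := by
  have hk := lt_numDecoded_iff_decodeTime_le c x ha (k := k) (t := t)
  rcases k with _ | k
  · omega
  · have hk' := lt_numDecoded_iff_decodeTime_le c x ha (k := k) (t := t)
    have := decodeTime_strictMono c x ha hc k.lt_succ_self
    simp only [Nat.succ_eq_add_one] at this
    omega

theorem numDecoded_zero : numDecoded c a x 0 = 0 := by
  simp [numDecoded, numArrivals_zero]

variable (Δ₀ : ℝ)

theorem leftLim_age_succ (n : ℕ) : Function.leftLim (age Δ₀ c a x) ((n + 1 : ℕ) : ℝ) =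
    (n + 1 : ℕ) - lastStamp Δ₀ c a x n := by
  refine leftLim_eq_of_tendsto ?_
  have h1 : Tendsto (fun t : ℝ => t - lastStamp Δ₀ c a x n) (𝓝[<] ((n + 1 : ℕ) : ℝ))
      (𝓝 ((n + 1 : ℕ) - lastStamp Δ₀ c a x n)) :=
    (Continuous.tendsto (by fun_prop) _).mono_left nhdsWithin_le_nhds
  refine h1.congr' ?_
  have h2 : Set.Ioo (n : ℝ) (n + 1 : ℕ) ∈ 𝓝[<] ((n + 1 : ℕ) : ℝ) :=
    Ioo_mem_nhdsLT (by push_cast; linarith)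
  filter_upwards [h2] with t ht
  have : ⌊t⌋₊ = n := (Nat.floor_eq_iff ((Nat.cast_nonneg n).trans ht.1.le)).2
    ⟨ht.1.le, by exact_mod_cast ht.2⟩
  simp [age, lastStamp, this]

theorem leftLim_age_zero : Function.leftLim (age Δ₀ c a x) ((0 : ℕ) : ℝ) = Δ₀ := by
  refine leftLim_eq_of_tendsto ?_
  have h1 : Tendsto (fun t : ℝ => t + Δ₀) (𝓝[<] ((0 : ℕ) : ℝ)) (𝓝 Δ₀) := by
    have : Tendsto (fun t : ℝ => t + Δ₀) (𝓝 0) (𝓝 (0 + Δ₀)) := Continuous.tendsto (by fun_prop) _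
    simpa using this.mono_left nhdsWithin_le_nhds
  refine h1.congr' ?_
  filter_upwards [self_mem_nhdsWithin] with t ht
  -- `⌊t⌋₊ = 0` for negative `t`, so the age is `t + Δ₀` to the left of `0` and there is no jump at
  -- time `0`.
  have : ⌊t⌋₊ = 0 := Nat.floor_of_nonpos (by simpa using (Set.mem_Iio.1 ht).le)
  simp [age, lastStamp, this, numDecoded_zero]

theorem isPeakTime_iff (ha : {t | Arrival a t}.Infinite) (hΔ₀ : 0 ≤ Δ₀) (n : ℕ) :
    IsPeakTime Δ₀ c a x n ↔ ∃ k, decodeTime c a x k = n := by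
  rw [IsPeakTime]
  rcases n with _ | n
  · rw [leftLim_age_zero]
    refine iff_of_false (by simp [age, lastStamp, numDecoded_zero]) ?_
    rintro ⟨k, hk⟩
    have := (arrival_timeStamp ha k).1
    rw [decodeTime] at hk
    omega
  · rw [leftLim_age_succ]
    have hmono : numDecoded c a x n ≤ numDecoded c a x (n + 1) := by
      by_contra! h
      rw [lt_numDecoded_iff_decodeTime_le c x ha] at h
      have := (lt_numDecoded_iff_decodeTime_le c x ha).2 (h.trans n.le_succ)
      exact lt_irrefl _ this
    have hlt : (∃ k, decodeTime c a x k = n + 1) ↔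
        numDecoded c a x n < numDecoded c a x (n + 1) := by
      constructor
      · rintro ⟨k, hk⟩
        have h1 := lt_numDecoded_iff_decodeTime_le c x ha (k := k) (t := n)
        have h2 := lt_numDecoded_iff_decodeTime_le c x ha (k := k) (t := n + 1)
        omega
      · intro h
        refine ⟨numDecoded c a x n, ?_⟩
        have h1 := lt_numDecoded_iff_decodeTime_le c x ha (k := numDecoded c a x n) (t := n)
        have h2 := lt_numDecoded_iff_decodeTime_le c x ha (k := numDecoded c a x n) (t := n + 1)
        omega
    rw [hlt, age, sub_lt_sub_iff_left, lastStamp, lastStamp, Nat.floor_natCast, Nat.floor_natCast]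
    generalize numDecoded c a x n = i at *
    generalize numDecoded c a x (n + 1) = j at *
    constructor
    · intro h
      refine hmono.lt_of_ne fun hij => ?_
      rw [hij] at h
      exact lt_irrefl _ h
    · intro h
      -- A new decoding raises the last stamp: from `-Δ₀ ≤ 0` to a stamp at least `1`, or from one
      -- stamp to a later one.
      rw [if_neg (by omega : ¬ j = 0)]
      split_ifs
      · have : 1 ≤ timeStamp a (j - 1) := (arrival_timeStamp ha _).1
        have : (1 : ℝ) ≤ timeStamp a (j - 1) := by exact_mod_cast this
        linarith
      · exact_mod_cast timeStamp_strictMono ha (by omega)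

theorem infinite_isPeakTime (ha : {t | Arrival a t}.Infinite)
    (hc : (∀ y, c y = []) ∨ ∀ y, c y ≠ []) (hΔ₀ : 0 ≤ Δ₀) :
    {n | IsPeakTime Δ₀ c a x n}.Infinite := by
  have : {n | IsPeakTime Δ₀ c a x n} = Set.range (decodeTime c a x) := by
    ext n; simp [isPeakTime_iff c x Δ₀ ha hΔ₀]
  rw [this]
  exact Set.infinite_range_of_injective (decodeTime_strictMono c x ha hc).injective

theorem nth_isPeakTime (ha : {t | Arrival a t}.Infinite)
    (hc : (∀ y, c y = []) ∨ ∀ y, c y ≠ []) (hΔ₀ : 0 ≤ Δ₀) (k : ℕ) :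
    Nat.nth (IsPeakTime Δ₀ c a x) k = decodeTime c a x k := by
  have hinf := infinite_isPeakTime c x Δ₀ ha hc hΔ₀
  have := Nat.nth_comp_of_strictMono (p := IsPeakTime Δ₀ c a x) (n := k)
    (decodeTime_strictMono c x ha hc)
    (fun n hn => (isPeakTime_iff c x Δ₀ ha hΔ₀ n).1 hn) (fun hf => absurd hf hinf)
  rw [← this, Nat.nth_of_forall fun n _ => (isPeakTime_iff c x Δ₀ ha hΔ₀ _).2 ⟨n, rfl⟩]

theorem peakAge_eq (ha : {t | Arrival a t}.Infinite)
    (hc : (∀ y, c y = []) ∨ ∀ y, c y ≠ []) (hΔ₀ : 0 ≤ Δ₀) (k : ℕ) :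
    peakAge Δ₀ c a x k =
      decodeTime c a x k - if k = 0 then -Δ₀ else (timeStamp a (k - 1) : ℝ) := by
  have h1 : 1 ≤ decodeTime c a x k :=
    (arrival_timeStamp ha k).1.trans (Nat.le_add_right _ _)
  obtain ⟨n, hn⟩ := Nat.exists_eq_add_of_le' h1
  rw [peakAge, nth_isPeakTime c x Δ₀ ha hc hΔ₀, hn, leftLim_age_succ, lastStamp,
    Nat.floor_natCast, numDecoded_eq_of_decodeTime c x ha hc hn.symm]

/-- The interarrival times telescope, with `-Δ₀` in the role of the stamp before the first. -/
theorem sum_peakAge (ha : {t | Arrival a t}.Infinite)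
    (hc : (∀ y, c y = []) ∨ ∀ y, c y ≠ []) (hΔ₀ : 0 ≤ Δ₀) (K : ℕ) :
    ∑ k ∈ Finset.range (K + 1), peakAge Δ₀ c a x k =
      ∑ k ∈ Finset.range (K + 1), ((buffer c a x (timeStamp a k)).length : ℝ)
        + timeStamp a K + Δ₀ := by
  induction K with
  | zero => simp [peakAge_eq c x Δ₀ ha hc hΔ₀, decodeTime]; ring
  | succ K ih =>
    rw [Finset.sum_range_succ, ih, Finset.sum_range_succ _ (K + 1),
      peakAge_eq c x Δ₀ ha hc hΔ₀, decodeTime]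
    simp; ring

theorem sum_arrival_eq (f : ℕ → ℝ) (T : ℕ) :
    ∑ t ∈ Finset.range T, (if Arrival a (t + 1) then f (t + 1) else 0) =
      ∑ k ∈ Finset.range (numArrivals a T), f (timeStamp a k) := by
  induction T with
  | zero => simp [numArrivals_zero]
  | succ T ih =>
    rw [Finset.sum_range_succ, ih, numArrivals_succ]
    split_ifs with h
    · rw [Finset.sum_range_succ]
      congr 2
      exact (Nat.nth_count h).symm
    · simp

theorem numArrivals_eq_sum (T : ℕ) : (numArrivals a T : ℝ) =
    ∑ t ∈ Finset.range T, if Arrival a (t + 1) then (1 : ℝ) else 0 := by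
  induction T with
  | zero => simp [numArrivals_zero]
  | succ T ih =>
    rw [Finset.sum_range_succ, ← ih, numArrivals_succ]
    split_ifs <;> simp

/-- The average peak age of a sample path, in terms of the arrival rate `q` and the rate `g` of
the buffer lengths found at the arrival times. -/
theorem tendsto_average_peakAge (hc : (∀ y, c y = []) ∨ ∀ y, c y ≠ []) (hΔ₀ : 0 ≤ Δ₀)
    {q g : ℝ} (hq : 0 < q)
    (hN : Tendsto (fun T : ℕ => (numArrivals a T : ℝ) / T) atTop (𝓝 q))
    (hG : Tendsto (fun T : ℕ => (∑ t ∈ Finset.range T,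
      if Arrival a (t + 1) then ((buffer c a x (t + 1)).length : ℝ) else 0) / T) atTop (𝓝 g)) :
    {n | IsPeakTime Δ₀ c a x n}.Infinite ∧
    Tendsto (fun K : ℕ => (1 / (K : ℝ)) * ∑ k ∈ Finset.range K, peakAge Δ₀ c a x k) atTop
      (𝓝 ((g + 1) / q)) := by
  -- Finitely many arrivals would give the rate `0` instead of `q > 0`.
  have ha : {t | Arrival a t}.Infinite := by
    intro hfin
    obtain ⟨M, hM⟩ : ∃ M, ∀ T, numArrivals a T ≤ M := by
      refine ⟨hfin.toFinset.card, fun T => ?_⟩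
      rw [numArrivals, Nat.count_eq_card_filter_range]
      exact Finset.card_le_card fun t ht => by simpa using (Finset.mem_filter.1 ht).2
    have h0 : Tendsto (fun T : ℕ => (numArrivals a T : ℝ) / T) atTop (𝓝 0) := by
      refine squeeze_zero (fun T => by positivity) (fun T => ?_)
        (tendsto_const_div_atTop_nhds_zero_nat (M : ℝ))
      gcongr
      exact hM T
    exact hq.ne (tendsto_nhds_unique h0 hN)
  refine ⟨infinite_isPeakTime c x Δ₀ ha hc hΔ₀, (tendsto_add_atTop_iff_nat 1).1 ?_⟩
  have hS : Tendsto (timeStamp a) atTop atTop := (timeStamp_strictMono ha).tendsto_atTop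
  -- Both rates are sampled at the time stamp of symbol `K`, by which exactly `K + 1` symbols have
  -- arrived.
  have hNS := hN.comp hS
  have hGS := hG.comp hS
  have hS' : Tendsto (fun K => Δ₀ / (timeStamp a K : ℝ)) atTop (𝓝 0) :=
    (tendsto_const_div_atTop_nhds_zero_nat Δ₀).comp hS
  have := ((hGS.add_const 1).add hS').div hNS hq.ne'
  rw [add_zero] at this
  refine this.congr fun K => ?_
  have hpos : (0 : ℝ) < timeStamp a K := by exact_mod_cast (arrival_timeStamp ha K).1
  have hK : (0 : ℝ) < (K : ℝ) + 1 := by positivity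
  simp only [Function.comp, Pi.div_apply]
  rw [sum_arrival_eq (fun t => ((buffer c a x t).length : ℝ)), numArrivals_timeStamp ha,
    sum_peakAge c x Δ₀ ha hc hΔ₀]
  push_cast
  field_simp

end SamplePath

/-! ### A strong law of large numbers for orthogonal increments. -/

section Averages

/-- Averages that vanish along the squares vanish, if the terms are `o(√t)`. -/
theorem tendsto_average_of_sq {D : ℕ → ℝ}
    (hsq : Tendsto (fun n : ℕ => (∑ t ∈ Finset.range (n ^ 2), D t) / (n : ℝ) ^ 2) atTop (𝓝 0))
    (hD : Tendsto (fun t : ℕ => D t / √t) atTop (𝓝 0)) :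
    Tendsto (fun T : ℕ => (∑ t ∈ Finset.range T, D t) / T) atTop (𝓝 0) := by
  have hsqrt : Tendsto Nat.sqrt atTop atTop :=
    tendsto_atTop.2 fun b => (eventually_ge_atTop (b ^ 2)).mono fun T hT => Nat.le_sqrt'.2 hT
  rw [Metric.tendsto_atTop] at hD
  have hS := hsq.comp hsqrt
  rw [Metric.tendsto_atTop] at hS ⊢
  intro ε hε
  obtain ⟨t₀, ht₀⟩ := hD (ε / 4) (by positivity)
  obtain ⟨T₀, hT₀⟩ := hS (ε / 2) (by positivity)
  refine ⟨max T₀ ((t₀ + 1) ^ 2), fun T hT => ?_⟩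
  have hT1 : T₀ ≤ T := (le_max_left _ _).trans hT
  have hT2 : t₀ + 1 ≤ T.sqrt := Nat.le_sqrt'.2 ((le_max_right _ _).trans hT)
  have h1 := hT₀ T hT1
  simp only [Function.comp, Real.dist_eq, sub_zero] at h1 ⊢
  set n := T.sqrt with hn
  have hn1 : n ^ 2 ≤ T := Nat.sqrt_le' T
  have hn2 : T ≤ n ^ 2 + 2 * n := by have := Nat.sqrt_le_add T; rw [← hn] at this; nlinarith
  have hnpos : (0 : ℝ) < n := by exact_mod_cast (by omega : 0 < n)
  have hTR : (n : ℝ) ^ 2 ≤ T := by exact_mod_cast hn1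
  have hTpos : (0 : ℝ) < T := lt_of_lt_of_le (by positivity) hTR
  have hnT : (n : ℝ) ≤ √T := Real.le_sqrt_of_sq_le hTR
  have hsplit : ∑ t ∈ Finset.range T, D t =
      ∑ t ∈ Finset.range (n ^ 2), D t + ∑ t ∈ Finset.Ico (n ^ 2) T, D t :=
    (Finset.sum_range_add_sum_Ico D hn1).symm
  -- Fewer than `2 n + 1` terms lie between `n ^ 2` and `T`, each at most `ε / 4 * √T`; since `n ≤
  -- √T`, they contribute at most `ε / 2 * T`.
  have hfill : |∑ t ∈ Finset.Ico (n ^ 2) T, D t| ≤ 2 * n * (ε / 4 * √T) := by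
    calc |∑ t ∈ Finset.Ico (n ^ 2) T, D t| ≤ ∑ t ∈ Finset.Ico (n ^ 2) T, |D t| :=
          Finset.abs_sum_le_sum_abs _ _
      _ ≤ ∑ t ∈ Finset.Ico (n ^ 2) T, ε / 4 * √T := by
          refine Finset.sum_le_sum fun t ht => ?_
          rw [Finset.mem_Ico] at ht
          have htt : t₀ < t := by nlinarith [ht.1]
          have hp : (0 : ℝ) < √t := Real.sqrt_pos.2 (by exact_mod_cast (by omega : 0 < t))
          have := ht₀ t htt.le
          rw [Real.dist_eq, sub_zero, abs_div, abs_of_pos hp, div_lt_iff₀ hp] at this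
          refine this.le.trans ?_
          have : √(t : ℝ) ≤ √T := Real.sqrt_le_sqrt (by exact_mod_cast ht.2.le)
          gcongr
      _ = (T - n ^ 2 : ℕ) * (ε / 4 * √T) := by simp
      _ ≤ 2 * n * (ε / 4 * √T) := by
          gcongr
          exact_mod_cast (by omega : T - n ^ 2 ≤ 2 * n)
  have hfill2 : 2 * n * (ε / 4 * √T) ≤ ε / 2 * T := by
    have : (n : ℝ) * √T ≤ T := by
      calc (n : ℝ) * √T ≤ √T * √T := by gcongr
        _ = T := Real.mul_self_sqrt hTpos.le
    nlinarith
  rw [abs_div, abs_of_pos (by positivity : (0 : ℝ) < n ^ 2), div_lt_iff₀ (by positivity)] at h1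
  rw [abs_div, abs_of_pos hTpos, div_lt_iff₀ hTpos, hsplit]
  calc _ ≤ |∑ t ∈ Finset.range (n ^ 2), D t| + |∑ t ∈ Finset.Ico (n ^ 2) T, D t| := abs_add_le _ _
    _ < ε / 2 * n ^ 2 + ε / 2 * T := add_lt_add_of_lt_of_le h1 (hfill.trans hfill2)
    _ ≤ ε * T := by nlinarith

variable {Ω : Type*} [MeasurableSpace Ω] {μ : Measure Ω}

/-- The sum of the `f n` has finite integral, hence is finite almost everywhere, and the terms of a
convergent series vanish. -/
theorem ae_tendsto_zero_of_summable_integral {f : ℕ → Ω → ℝ} (hf0 : ∀ n ω, 0 ≤ f n ω)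
    (hf : ∀ n, Integrable (f n) μ) {b : ℕ → ℝ} (hb : Summable b) (hfb : ∀ n, ∫ ω, f n ω ∂μ ≤ b n) :
    ∀ᵐ ω ∂μ, Tendsto (fun n => f n ω) atTop (𝓝 0) := by
  have hsum : Summable fun n => ∫ ω, f n ω ∂μ :=
    hb.of_nonneg_of_le (fun n => integral_nonneg (hf0 n)) hfb
  have hfin : ∫⁻ ω, ∑' n, ENNReal.ofReal (f n ω) ∂μ ≠ ⊤ := by
    rw [lintegral_tsum fun n => (hf n).aestronglyMeasurable.aemeasurable.ennreal_ofReal]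
    have : ∀ n, ∫⁻ ω, ENNReal.ofReal (f n ω) ∂μ = ENNReal.ofReal (∫ ω, f n ω ∂μ) := fun n =>
      (ofReal_integral_eq_lintegral_ofReal (hf n) (ae_of_all _ (hf0 n))).symm
    simp_rw [this]
    rw [← ENNReal.ofReal_tsum_of_nonneg (fun n => integral_nonneg (hf0 n)) hsum]
    exact ENNReal.ofReal_ne_top
  have hae := ae_lt_top' (AEMeasurable.tsum
    fun n => (hf n).aestronglyMeasurable.aemeasurable.ennreal_ofReal) hfin
  filter_upwards [hae] with ω hω
  have := ENNReal.tendsto_atTop_zero_of_tsum_ne_top hω.ne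
  have h2 := (ENNReal.tendsto_toReal ENNReal.zero_ne_top).comp this
  simpa [Function.comp_def, ENNReal.toReal_ofReal (hf0 _ _)] using h2

/-- A strong law for bounded-variance orthogonal increments of size `o(√t)`. -/
theorem ae_tendsto_average_of_orthogonal {D : ℕ → Ω → ℝ}
    (hint : ∀ s t, Integrable (fun ω => D s ω * D t ω) μ)
    (horth : ∀ s t, s < t → ∫ ω, D s ω * D t ω ∂μ = 0)
    {C : ℝ} (hvar : ∀ t, ∫ ω, D t ω ^ 2 ∂μ ≤ C)
    (hsmall : ∀ᵐ ω ∂μ, Tendsto (fun t : ℕ => D t ω / √t) atTop (𝓝 0)) :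
    ∀ᵐ ω ∂μ, Tendsto (fun T : ℕ => (∑ t ∈ Finset.range T, D t ω) / T) atTop (𝓝 0) := by
  have hsqint : ∀ T, Integrable (fun ω => (∑ t ∈ Finset.range T, D t ω) ^ 2) μ := by
    intro T
    simp_rw [sq, Finset.sum_mul_sum]
    exact integrable_finsetSum _ fun s _ => integrable_finsetSum _ fun t _ => hint s t
  have hM : ∀ T : ℕ, ∫ ω, (∑ t ∈ Finset.range T, D t ω) ^ 2 ∂μ ≤ T * C := by
    intro T
    have horth' : ∀ s t, s ≠ t → ∫ ω, D s ω * D t ω ∂μ = 0 := by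
      intro s t hst
      rcases hst.lt_or_gt with h | h
      · exact horth s t h
      · simpa only [mul_comm] using horth t s h
    calc ∫ ω, (∑ t ∈ Finset.range T, D t ω) ^ 2 ∂μ
        = ∑ s ∈ Finset.range T, ∑ t ∈ Finset.range T, ∫ ω, D s ω * D t ω ∂μ := by
          simp_rw [sq, Finset.sum_mul_sum]
          rw [integral_finsetSum _ fun s _ => integrable_finsetSum _ fun t _ => hint s t]
          exact Finset.sum_congr rfl fun s _ => integral_finsetSum _ fun t _ => hint s t
      _ = ∑ s ∈ Finset.range T, ∫ ω, D s ω ^ 2 ∂μ := by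
          refine Finset.sum_congr rfl fun s hs => ?_
          rw [Finset.sum_eq_single_of_mem s hs fun t _ ht => horth' s t ht.symm]
          simp_rw [sq]
      _ ≤ ∑ s ∈ Finset.range T, C := Finset.sum_le_sum fun s _ => hvar s
      _ = T * C := by simp
  -- By orthogonality the second moment of the average over `n ^ 2` terms is at most `C / n ^ 2`,
  -- which is summable.
  have hsub : ∀ᵐ ω ∂μ, Tendsto (fun n : ℕ =>
      ((∑ t ∈ Finset.range (n ^ 2), D t ω) / (n : ℝ) ^ 2) ^ 2) atTop (𝓝 0) := by
    refine ae_tendsto_zero_of_summable_integral (b := fun n : ℕ => C * (1 / (n : ℝ) ^ 2))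
      (fun n ω => sq_nonneg _) (fun n => ?_)
      ((Real.summable_one_div_nat_pow.2 (by norm_num)).mul_left C) (fun n => ?_)
    · simp_rw [div_pow]; exact (hsqint _).div_const _
    · simp_rw [div_pow]
      rw [integral_div]
      rcases Nat.eq_zero_or_pos n with rfl | hn
      · simp
      · have hn' : (0 : ℝ) < n := by exact_mod_cast hn
        rw [div_le_iff₀ (by positivity)]
        refine (hM _).trans (le_of_eq ?_)
        push_cast
        field_simp
  filter_upwards [hsub, hsmall] with ω h1 h2
  refine tendsto_average_of_sq ?_ h2
  have := (Real.continuous_sqrt.tendsto _).comp h1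
  simp only [Function.comp_def, Real.sqrt_sq_eq_abs, Real.sqrt_zero] at this
  exact (tendsto_zero_iff_abs_tendsto_zero _).2 this

end Averages

/-! ### The single-server queue with i.i.d. marks: moment bounds and time averages. -/

section MarkedQueue

/-- The first `t` values of a sequence, the latest one first. -/
def history {E : Type*} (y : ℕ → E) : ℕ → List E
  | 0 => []
  | t + 1 => y t :: history y t

theorem length_history {E : Type*} (y : ℕ → E) (t : ℕ) : (history y t).length = t := by
  induction t with
  | zero => rfl
  | succ t ih => simp [history, ih]

theorem drop_history_add {E : Type*} (y : ℕ → E) (s k : ℕ) :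
    (history y (s + k)).drop k = history y s := by
  induction k with
  | zero => simp
  | succ k ih => rw [← add_assoc]; simpa [history] using ih

/-- The work left in a discrete-time single-server queue that serves one unit per time unit; the
mark `e` brings the work `len e`. -/
def backlog {E : Type*} (len : E → ℕ) : List E → ℕ
  | [] => 0
  | e :: h => backlog len h + len e - 1

/-- The martingale increment `F h * g e` as a function of the extended history. -/
def increment {E : Type*} (F : List E → ℝ) (g : E → ℝ) : List E → ℝ
  | [] => 0
  | e :: h => F h * g e

variable {E : Type*} {π : E → ℝ} {len : E → ℕ}

/-- The derivative of the sum at `θ = 0` is the mean drift, which is negative; `exp x ≤ 1 + x + x ^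
2` for `|x| ≤ 1` makes this quantitative. -/
theorem exists_exp_drift [Fintype E] (hπ0 : ∀ e, 0 ≤ π e) (hπ1 : ∑ e, π e = 1)
    (hstable : ∑ e, π e * len e < 1) :
    ∃ θ : ℝ, 0 < θ ∧ ∑ e, π e * Real.exp (θ * (len e - 1)) < 1 := by
  set m := ∑ e, π e * (len e : ℝ) with hm
  have hm0 : 0 ≤ m := Finset.sum_nonneg fun e _ => mul_nonneg (hπ0 e) (Nat.cast_nonneg _)
  obtain ⟨B, hB⟩ := ((Set.finite_univ (α := E)).image fun e => |(len e : ℝ) - 1|).bddAbove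
  obtain ⟨b, hb1, hB⟩ : ∃ b : ℝ, 1 ≤ b ∧ ∀ e, |(len e : ℝ) - 1| ≤ b :=
    ⟨max B 1, le_max_right _ _, fun e => (hB ⟨e, trivial, rfl⟩).trans (le_max_left _ _)⟩
  have hθ : 0 < (1 - m) / (2 * b ^ 2) := by
    have : 0 < 1 - m := by linarith
    positivity
  -- With `b` bounding `|len e - 1|`, this `θ` minimizes the bound `1 - θ (1 - m) + θ ^ 2 b ^ 2`; `b
  -- ≥ 1` ensures `θ b ≤ 1`.
  refine ⟨(1 - m) / (2 * b ^ 2), hθ, ?_⟩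
  set θ := (1 - m) / (2 * b ^ 2) with hθdef
  have hθb2 : θ * b ^ 2 = (1 - m) / 2 := by rw [hθdef]; field_simp
  have hθb : θ * b ≤ 1 := by nlinarith [mul_nonneg hθ.le (by positivity : 0 ≤ b)]
  calc ∑ e, π e * Real.exp (θ * (len e - 1))
      ≤ ∑ e, π e * (1 + θ * (len e - 1) + θ ^ 2 * b ^ 2) := by
        refine Finset.sum_le_sum fun e _ => mul_le_mul_of_nonneg_left ?_ (hπ0 e)
        have habs : |θ * ((len e : ℝ) - 1)| ≤ 1 := by
          rw [abs_mul, abs_of_pos hθ]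
          exact (mul_le_mul_of_nonneg_left (hB e) hθ.le).trans hθb
        have h1 := (abs_le.1 (Real.abs_exp_sub_one_sub_id_le habs)).2
        have h2 : ((len e : ℝ) - 1) ^ 2 ≤ b ^ 2 :=
          sq_le_sq' (abs_le.1 (hB e)).1 (abs_le.1 (hB e)).2
        have h3 := mul_le_mul_of_nonneg_left h2 (sq_nonneg θ)
        rw [mul_pow] at h1
        linarith
    _ = (1 + θ ^ 2 * b ^ 2 - θ) * ∑ e, π e + θ * m := by
        rw [hm, Finset.mul_sum, Finset.mul_sum, ← Finset.sum_add_distrib]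
        exact Finset.sum_congr rfl fun e _ => by ring
    _ = 1 - θ * ((1 - m) / 2) := by
        rw [hπ1, ← hθb2]
        have : θ * m = θ - θ * (1 - m) := by ring
        rw [this, show 1 - m = 2 * (θ * b ^ 2) by rw [hθb2]; ring]
        ring
    _ < 1 := by nlinarith

/-- The extra `1` pays for the truncation at zero, where the left side equals `1`. -/
theorem exp_backlog_cons_le (θ : ℝ) (e : E) (h : List E) :
    Real.exp (θ * backlog len (e :: h)) ≤
      Real.exp (θ * backlog len h) * Real.exp (θ * (len e - 1)) + 1 := by
  rw [← Real.exp_add, backlog]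
  rcases Nat.eq_zero_or_pos (backlog len h + len e) with h0 | h0
  · simp only [h0, Nat.zero_sub, Nat.cast_zero, mul_zero, Real.exp_zero]
    linarith [Real.exp_pos (θ * backlog len h + θ * (len e - 1))]
  · rw [Nat.cast_sub h0]
    push_cast
    rw [← mul_add, add_sub_assoc]
    linarith

/-- The quadratic energy balance of the backlog. -/
theorem backlog_sq_add (y : ℕ → E) (T : ℕ) :
    (backlog len (history y T) : ℝ) ^ 2 + backlog len (history y T) =
      ∑ t ∈ Finset.range T, (2 * (backlog len (history y t) * ((len (y t) : ℝ) - 1)) +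
        len (y t) * ((len (y t) : ℝ) - 1)) := by
  induction T with
  | zero => simp [history, backlog]
  | succ T ih =>
    rw [Finset.sum_range_succ, ← ih]
    simp only [history, backlog]
    -- With `U' = U + ℓ - 1` one has `U' ^ 2 + U' = (U + ℓ - 1) (U + ℓ)`. This vanishes when `U + ℓ
    -- = 0`, so the truncation leaves no error term; hence `U ^ 2 + U` rather than `U ^ 2`.
    rcases Nat.eq_zero_or_pos (backlog len (history y T) + len (y T)) with h0 | h0
    · have h1 : backlog len (history y T) = 0 := by omega
      have h2 : len (y T) = 0 := by omega
      simp [h1, h2]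
    · rw [Nat.cast_sub h0]
      push_cast
      ring

variable {Ω : Type*} [MeasurableSpace Ω] {μ : Measure Ω}
  [Fintype E] [MeasurableSpace E] [DiscreteMeasurableSpace E]
  [MeasurableSpace (List E)] [DiscreteMeasurableSpace (List E)]
  {Y : ℕ → Ω → E}

theorem measurable_history (hY : ∀ t, Measurable (Y t)) (t : ℕ) :
    Measurable fun ω => history (fun s => Y s ω) t := by
  induction t with
  | zero => exact measurable_const
  | succ t ih =>
    refine measurable_to_countable' fun l => ?_
    rcases l with _ | ⟨e, h⟩
    · convert MeasurableSet.empty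
      ext ω; simp [history]
    · have h1 := (hY t) (measurableSet_singleton e)
      have h2 := ih (measurableSet_singleton h)
      convert h1.inter h2
      ext ω; simp [history]

/-- A history of fixed length over a finite alphabet takes finitely many values, so any function of
it is bounded. -/
theorem integrable_comp_history [IsProbabilityMeasure μ]
    (hY : ∀ t, Measurable (Y t)) (F : List E → ℝ) (t : ℕ) :
    Integrable (fun ω => F (history (fun s => Y s ω) t)) μ := by
  obtain ⟨C, hC⟩ := ((List.finite_length_eq E t).image fun l => ‖F l‖).bddAbove
  refine Integrable.of_bound
    ((Measurable.of_discrete (f := F)).comp (measurable_history hY t)).aestronglyMeasurable C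
    (ae_of_all _ fun ω => hC ⟨_, length_history _ t, rfl⟩)

theorem integral_history_mul (hY : ∀ t, Measurable (Y t))
    (hind : ∀ t, IndepFun (fun ω => history (fun s => Y s ω) t) (Y t) μ)
    (F : List E → ℝ) (g : E → ℝ) (t : ℕ) :
    ∫ ω, F (history (fun s => Y s ω) t) * g (Y t ω) ∂μ =
      (∫ ω, F (history (fun s => Y s ω) t) ∂μ) * ∫ ω, g (Y t ω) ∂μ :=
  (hind t).integral_fun_comp_mul_comp (measurable_history hY t).aemeasurable (hY t).aemeasurable
    Measurable.of_discrete.aestronglyMeasurable Measurable.of_discrete.aestronglyMeasurable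

/-- The summands are martingale differences: a centred function of the fresh mark times a function
of the past. -/
theorem ae_tendsto_average_increment [IsProbabilityMeasure μ]
    (hY : ∀ t, Measurable (Y t))
    (hind : ∀ t, IndepFun (fun ω => history (fun s => Y s ω) t) (Y t) μ)
    (F : List E → ℝ) (g : E → ℝ) (hg : ∀ t, ∫ ω, g (Y t ω) ∂μ = 0) {C : ℝ}
    (hF : ∀ t, ∫ ω, F (history (fun s => Y s ω) t) ^ 2 ∂μ ≤ C)
    (hsmall : ∀ᵐ ω ∂μ, Tendsto (fun t : ℕ => F (history (fun s => Y s ω) t) / √t) atTop (𝓝 0)) :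
    ∀ᵐ ω ∂μ, Tendsto (fun T : ℕ => (∑ t ∈ Finset.range T,
      F (history (fun s => Y s ω) t) * g (Y t ω)) / T) atTop (𝓝 0) := by
  obtain ⟨B, hB⟩ := ((Set.finite_univ (α := E)).image fun e => |g e|).bddAbove
  have hB : ∀ e, |g e| ≤ B := fun e => hB ⟨e, trivial, rfl⟩
  refine ae_tendsto_average_of_orthogonal (C := C * B ^ 2) ?_ ?_ ?_ ?_
  · have key : ∀ s t, s ≤ t → Integrable (fun ω => F (history (fun s => Y s ω) s) * g (Y s ω) *
        (F (history (fun s => Y s ω) t) * g (Y t ω))) μ := by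
      intro s t hst
      obtain ⟨k, rfl⟩ := Nat.exists_eq_add_of_le hst
      refine (integrable_comp_history hY (fun l => increment F g (l.drop k) * increment F g l)
        (s + k + 1)).congr (ae_of_all _ fun ω => ?_)
      have : (history (fun s => Y s ω) (s + k + 1)).drop k = history (fun s => Y s ω) (s + 1) := by
        rw [add_right_comm]; exact drop_history_add _ _ _
      simp only [this]
      rfl
    intro s t
    rcases le_total s t with h | h
    · exact key s t h
    · exact (key t s h).congr (ae_of_all _ fun ω => mul_comm _ _)
  · intro s t hst
    obtain ⟨k, rfl⟩ := Nat.exists_eq_add_of_le (Nat.succ_le_of_lt hst)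
    -- Histories list the latest mark first, so dropping `k` entries recovers the earlier one: the
    -- earlier increment is a function of the history preceding the later mark.
    have := integral_history_mul hY hind (fun l => increment F g (l.drop k) * F l) g (s.succ + k)
    rw [hg, mul_zero] at this
    rw [← this]
    refine integral_congr_ae (ae_of_all _ fun ω => ?_)
    simp only [drop_history_add]
    simp only [Nat.succ_eq_add_one, history, increment]
    ring
  · intro t
    calc ∫ ω, (F (history (fun s => Y s ω) t) * g (Y t ω)) ^ 2 ∂μ
        ≤ ∫ ω, F (history (fun s => Y s ω) t) ^ 2 * B ^ 2 ∂μ := by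
          refine integral_mono_of_nonneg (ae_of_all _ fun ω => sq_nonneg _)
            ((integrable_comp_history hY (fun l => F l ^ 2) t).mul_const _)
            (ae_of_all _ fun ω => ?_)
          have : g (Y t ω) ^ 2 ≤ B ^ 2 := sq_le_sq' (abs_le.1 (hB _)).1 (abs_le.1 (hB _)).2
          simp only [mul_pow]
          gcongr
      _ = (∫ ω, F (history (fun s => Y s ω) t) ^ 2 ∂μ) * B ^ 2 := integral_mul_const _ _
      _ ≤ C * B ^ 2 := by gcongr; exact hF t
  · filter_upwards [hsmall] with ω hω
    have h0 := hω.abs.mul_const B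
    rw [abs_zero, zero_mul] at h0
    refine squeeze_zero_norm (fun t => ?_) h0
    rw [Real.norm_eq_abs, mul_div_right_comm, abs_mul]
    gcongr
    exact hB _

theorem exists_integral_pow_backlog_le [IsProbabilityMeasure μ]
    (hY : ∀ t, Measurable (Y t))
    (hind : ∀ t, IndepFun (fun ω => history (fun s => Y s ω) t) (Y t) μ)
    (hπ0 : ∀ e, 0 ≤ π e) (hlaw : ∀ t (f : E → ℝ), ∫ ω, f (Y t ω) ∂μ = ∑ e, π e * f e)
    (hstable : ∑ e, π e * len e < 1) (n : ℕ) :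
    ∃ C, 0 ≤ C ∧ ∀ t, ∫ ω, (backlog len (history (fun s => Y s ω) t) : ℝ) ^ n ∂μ ≤ C := by
  have hπ1 : ∑ e, π e = 1 := by simpa using (hlaw 0 fun _ => 1).symm
  obtain ⟨θ, hθ, hr⟩ := exists_exp_drift hπ0 hπ1 hstable
  set r := ∑ e, π e * Real.exp (θ * (len e - 1)) with hrdef
  have hr0 : 0 ≤ r := Finset.sum_nonneg fun e _ => mul_nonneg (hπ0 e) (Real.exp_pos _).le
  have hr1 : 0 < 1 - r := by linarith
  -- `1 / (1 - r)` is the fixed point of `z ↦ r * z + 1`, the recursion that bounds the exponential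
  -- moment.
  have hexp : ∀ t, ∫ ω, Real.exp (θ * backlog len (history (fun s => Y s ω) t)) ∂μ ≤
      1 / (1 - r) := by
    intro t
    induction t with
    | zero =>
      simp only [history, backlog, Nat.cast_zero, mul_zero, Real.exp_zero, integral_const,
        probReal_univ, smul_eq_mul, mul_one]
      rw [le_div_iff₀ hr1]; linarith
    | succ t ih =>
      have hI := integral_history_mul hY hind (fun l => Real.exp (θ * backlog len l))
        (fun e => Real.exp (θ * (len e - 1))) t
      rw [hlaw t fun e => Real.exp (θ * (len e - 1))] at hI
      have hint : Integrable (fun ω => Real.exp (θ * backlog len (history (fun s => Y s ω) t)) *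
          Real.exp (θ * (len (Y t ω) - 1))) μ :=
        integrable_comp_history hY (increment (fun l => Real.exp (θ * backlog len l))
          fun e => Real.exp (θ * (len e - 1))) (t + 1)
      calc ∫ ω, Real.exp (θ * backlog len (history (fun s => Y s ω) (t + 1))) ∂μ
          ≤ ∫ ω, (Real.exp (θ * backlog len (history (fun s => Y s ω) t)) *
              Real.exp (θ * (len (Y t ω) - 1)) + 1) ∂μ := by
            refine integral_mono
              (integrable_comp_history hY (fun l => Real.exp (θ * backlog len l)) (t + 1))
              (hint.add (integrable_const 1)) fun ω => exp_backlog_cons_le θ _ _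
        _ = (∫ ω, Real.exp (θ * backlog len (history (fun s => Y s ω) t)) ∂μ) * r + 1 := by
            rw [integral_add hint (integrable_const 1), hI, ← hrdef]; simp
        _ ≤ 1 / (1 - r) * r + 1 := by gcongr
        _ = 1 / (1 - r) := by field_simp; ring
  refine ⟨n.factorial / θ ^ n * (1 / (1 - r)), by positivity, fun t => ?_⟩
  calc ∫ ω, (backlog len (history (fun s => Y s ω) t) : ℝ) ^ n ∂μ
      ≤ ∫ ω, n.factorial / θ ^ n *
          Real.exp (θ * backlog len (history (fun s => Y s ω) t)) ∂μ := by
        refine integral_mono (integrable_comp_history hY (fun l => (backlog len l : ℝ) ^ n) t)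
          ((integrable_comp_history hY (fun l => Real.exp (θ * backlog len l)) t).const_mul _)
          fun ω => ?_
        have := Real.pow_div_factorial_le_exp
          (θ * backlog len (history (fun s => Y s ω) t)) (by positivity) n
        rw [div_le_iff₀ (by positivity), mul_pow] at this
        rw [div_mul_eq_mul_div, le_div_iff₀ (by positivity)]
        linarith
    _ = n.factorial / θ ^ n *
          ∫ ω, Real.exp (θ * backlog len (history (fun s => Y s ω) t)) ∂μ :=
        integral_const_mul _ _
    _ ≤ _ := by gcongr; exact hexp t

/-- Bounded fourth moments make the means of `U t ^ 4 / t ^ 2` summable; two square roots then give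
the rate. -/
theorem ae_backlog_isLittleO_sqrt [IsProbabilityMeasure μ]
    (hY : ∀ t, Measurable (Y t))
    (hind : ∀ t, IndepFun (fun ω => history (fun s => Y s ω) t) (Y t) μ)
    (hπ0 : ∀ e, 0 ≤ π e) (hlaw : ∀ t (f : E → ℝ), ∫ ω, f (Y t ω) ∂μ = ∑ e, π e * f e)
    (hstable : ∑ e, π e * len e < 1) :
    ∀ᵐ ω ∂μ, Tendsto (fun t : ℕ => (backlog len (history (fun s => Y s ω) t) : ℝ) / √t)
      atTop (𝓝 0) := by
  obtain ⟨C, hC0, hC⟩ := exists_integral_pow_backlog_le hY hind hπ0 hlaw hstable 4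
  have := ae_tendsto_zero_of_summable_integral (μ := μ)
    (f := fun t ω => (backlog len (history (fun s => Y s ω) t) : ℝ) ^ 4 / (t : ℝ) ^ 2)
    (b := fun t : ℕ => C * (1 / (t : ℝ) ^ 2)) (fun t ω => by positivity)
    (fun t => (integrable_comp_history hY (fun l => (backlog len l : ℝ) ^ 4) t).div_const _)
    ((Real.summable_one_div_nat_pow.2 (by norm_num)).mul_left C)
    (fun t => by
      rw [integral_div, mul_one_div]
      gcongr
      exact hC t)
  filter_upwards [this] with ω hω
  have h2 := (Real.continuous_sqrt.tendsto _).comp ((Real.continuous_sqrt.tendsto _).comp hω)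
  simp only [Real.sqrt_zero] at h2
  refine h2.congr fun t => ?_
  simp only [Function.comp]
  rw [show (backlog len (history (fun s => Y s ω) t) : ℝ) ^ 4 / (t : ℝ) ^ 2 =
    ((backlog len (history (fun s => Y s ω) t) : ℝ) ^ 2 / t) ^ 2 by rw [div_pow]; ring,
    Real.sqrt_sq (by positivity), Real.sqrt_div (by positivity), Real.sqrt_sq (by positivity)]

theorem ae_tendsto_average_mark [IsProbabilityMeasure μ]
    (hY : ∀ t, Measurable (Y t))
    (hind : ∀ t, IndepFun (fun ω => history (fun s => Y s ω) t) (Y t) μ)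
    (hlaw : ∀ t (f : E → ℝ), ∫ ω, f (Y t ω) ∂μ = ∑ e, π e * f e) (g : E → ℝ) :
    ∀ᵐ ω ∂μ, Tendsto (fun T : ℕ => (∑ t ∈ Finset.range T, g (Y t ω)) / T) atTop
      (𝓝 (∑ e, π e * g e)) := by
  have hπ1 : ∑ e, π e = 1 := by simpa using (hlaw 0 fun _ => 1).symm
  have := ae_tendsto_average_increment hY hind (fun _ => 1) (fun e => g e - ∑ e, π e * g e)
    (fun t => by
      rw [hlaw t fun e => g e - ∑ e, π e * g e]
      simp [mul_sub, Finset.sum_sub_distrib, ← Finset.sum_mul, hπ1])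
    (C := 1) (fun t => by simp)
    (ae_of_all _ fun ω => by
      simp_rw [one_div]
      exact tendsto_inv_atTop_zero.comp (Real.tendsto_sqrt_atTop.comp tendsto_natCast_atTop_atTop))
  filter_upwards [this] with ω hω
  have h := hω.add_const (∑ e, π e * g e)
  rw [zero_add] at h
  refine h.congr' ?_
  filter_upwards [eventually_gt_atTop 0] with T hT
  have hT : (0 : ℝ) < T := by exact_mod_cast hT
  simp only [one_mul, Finset.sum_sub_distrib, Finset.sum_const, Finset.card_range, nsmul_eq_mul]
  field_simp
  ring

/-- Marks may be replaced by their means against the backlog. Dividing the energy balance by `T`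
then leaves `0 = 2 (m - 1) * u + v` for the limiting average backlog `u`. -/
theorem ae_tendsto_average_backlog_mul [IsProbabilityMeasure μ]
    (hY : ∀ t, Measurable (Y t))
    (hind : ∀ t, IndepFun (fun ω => history (fun s => Y s ω) t) (Y t) μ)
    (hπ0 : ∀ e, 0 ≤ π e) (hlaw : ∀ t (f : E → ℝ), ∫ ω, f (Y t ω) ∂μ = ∑ e, π e * f e)
    (hstable : ∑ e, π e * len e < 1) (g : E → ℝ) :
    ∀ᵐ ω ∂μ, Tendsto (fun T : ℕ => (∑ t ∈ Finset.range T,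
        (backlog len (history (fun s => Y s ω) t) : ℝ) * g (Y t ω)) / T) atTop
      (𝓝 ((∑ e, π e * (len e * ((len e : ℝ) - 1))) / (2 * (1 - ∑ e, π e * len e)) *
        ∑ e, π e * g e)) := by
  have hπ1 : ∑ e, π e = 1 := by simpa using (hlaw 0 fun _ => 1).symm
  have hsmall := ae_backlog_isLittleO_sqrt hY hind hπ0 hlaw hstable
  obtain ⟨C, -, hC⟩ := exists_integral_pow_backlog_le hY hind hπ0 hlaw hstable 2
  have hmart : ∀ f : E → ℝ, ∀ᵐ ω ∂μ, Tendsto (fun T : ℕ => (∑ t ∈ Finset.range T,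
      (backlog len (history (fun s => Y s ω) t) : ℝ) * (f (Y t ω) - ∑ e, π e * f e)) / T)
      atTop (𝓝 0) := fun f =>
    ae_tendsto_average_increment hY hind (fun l => (backlog len l : ℝ))
      (fun e => f e - ∑ e, π e * f e) (fun t => by
        rw [hlaw t fun e => f e - ∑ e, π e * f e]
        simp [mul_sub, Finset.sum_sub_distrib, ← Finset.sum_mul, hπ1]) hC hsmall
  filter_upwards [hsmall, hmart g, hmart (fun e => (len e : ℝ)),
    ae_tendsto_average_mark hY hind hlaw fun e => len e * ((len e : ℝ) - 1)] with ω h0 h1 h2 h3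
  set U : ℕ → ℝ := fun t => backlog len (history (fun s => Y s ω) t) with hU
  set m := ∑ e, π e * (len e : ℝ) with hm
  set v := ∑ e, π e * (len e * ((len e : ℝ) - 1)) with hv
  have hm1 : 0 < 1 - m := by linarith
  have hU1 : Tendsto (fun T : ℕ => (U T ^ 2 + U T) / T) atTop (𝓝 0) := by
    have hsq : Tendsto (fun T : ℕ => U T ^ 2 / T) atTop (𝓝 0) := by
      have := h0.pow 2
      rw [zero_pow two_ne_zero] at this
      refine this.congr fun T => ?_
      rw [div_pow, Real.sq_sqrt (Nat.cast_nonneg T)]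
    have hsq2 := hsq.const_mul 2
    rw [mul_zero] at hsq2
    refine squeeze_zero (fun T => ?_) (fun T => ?_) hsq2
    · have : 0 ≤ U T := Nat.cast_nonneg _
      positivity
    -- The backlog is a natural number, so it is at most its square.
    · have : U T ≤ U T ^ 2 := by
        simp only [hU]
        exact_mod_cast Nat.le_self_pow two_ne_zero _
      rw [mul_div_assoc']
      gcongr
      linarith
  have havg : Tendsto (fun T : ℕ => (∑ t ∈ Finset.range T, U t) / T) atTop
      (𝓝 (v / (2 * (1 - m)))) := by
    have h := ((h3.add (h2.const_mul 2)).sub hU1).div_const (2 * (1 - m))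
    simp only [mul_zero, add_zero, sub_zero] at h
    refine h.congr fun T => ?_
    have hE := backlog_sq_add (len := len) (fun s => Y s ω) T
    rw [show U T ^ 2 + U T = _ from hE]
    rw [div_eq_iff (by positivity), mul_div_assoc', ← add_div, ← sub_div, div_mul_eq_mul_div]
    congr 1
    rw [Finset.sum_mul, Finset.mul_sum, ← Finset.sum_add_distrib, ← Finset.sum_sub_distrib]
    exact Finset.sum_congr rfl fun t _ => by simp only [hU]; ring
  have h := h1.add (havg.mul_const (∑ e, π e * g e))
  rw [zero_add] at h
  refine h.congr fun T => ?_
  rw [div_mul_eq_mul_div, ← add_div, Finset.sum_mul, ← Finset.sum_add_distrib]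
  congr 1
  exact Finset.sum_congr rfl fun t _ => by simp only [hU]; ring

end MarkedQueue

/-! ### The buffer as a marked queue, and the i.i.d. law of the marks. -/

section Marks

/-- The symbol that arrives at time `t + 1`, if there is one. -/
def mark {𝒳 : Type*} (a : ℕ → Bool) (x : ℕ → 𝒳) (t : ℕ) : Option 𝒳 :=
  if a (t + 1) = true then some (x (numArrivals a t)) else none

/-- The number of bits brought by a mark. -/
def markLength {𝒳 : Type*} (c : 𝒳 → List Bool) : Option 𝒳 → ℕ
  | none => 0
  | some y => (c y).length

/-- The distribution of a mark. -/
noncomputable def markLaw {𝒳 : Type*} (q : ℝ) (P : PMF 𝒳) : Option 𝒳 → ℝ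
  | none => 1 - q
  | some y => q * (P y).toReal

theorem sum_markLaw_mul [Fintype 𝒳] (q : ℝ) (P : PMF 𝒳) (f : Option 𝒳 → ℝ) :
    ∑ e, markLaw q P e * f e = (1 - q) * f none + q * ∑ y, (P y).toReal * f (some y) := by
  rw [Fintype.sum_option, Finset.mul_sum]
  simp [markLaw, mul_assoc]

theorem arrival_succ_iff (a : ℕ → Bool) (t : ℕ) : Arrival a (t + 1) ↔ a (t + 1) = true := by
  simp [Arrival]

theorem length_buffer_succ_eq_mark {𝒳 : Type*} (c : 𝒳 → List Bool) (a : ℕ → Bool) (x : ℕ → 𝒳)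
    (t : ℕ) : (buffer c a x (t + 1)).length =
      (buffer c a x t).length - 1 + markLength c (mark a x t) := by
  rw [length_buffer_succ, mark]
  simp only [arrival_succ_iff]
  split_ifs <;> rfl

/-- Truncated subtraction matches an idle server. The backlog is taken after the departing bit is
removed and before the next arrival, hence is independent of the next mark. -/
theorem length_buffer_sub_one {𝒳 : Type*} (c : 𝒳 → List Bool) (a : ℕ → Bool) (x : ℕ → 𝒳)
    (t : ℕ) : (buffer c a x t).length - 1 = backlog (markLength c) (history (mark a x) t) := by
  induction t with
  | zero => rfl
  | succ t ih => rw [length_buffer_succ_eq_mark, ih]; rfl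

theorem forall_lt_succ_eq_update_iff {α : Type*} {f b : ℕ → α} {n : ℕ} {v : α} :
    (∀ s < n + 1, f s = Function.update b n v s) ↔ (∀ s < n, f s = b s) ∧ f n = v := by
  rw [Nat.forall_lt_succ_right]
  refine and_congr (forall₂_congr fun s hs => ?_) (by simp)
  rw [Function.update_of_ne hs.ne]

theorem prod_range_succ_update {α M : Type*} [CommMonoid M] (f : α → M) (b : ℕ → α) (n : ℕ)
    (v : α) : ∏ s ∈ Finset.range (n + 1), f (Function.update b n v s) =
      (∏ s ∈ Finset.range n, f (b s)) * f v := by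
  rw [Finset.prod_range_succ, Function.update_self]
  congr 1
  refine Finset.prod_congr rfl fun s hs => ?_
  rw [Function.update_of_ne (Finset.mem_range.1 hs).ne]

/-- A history of marks determines the arrivals and the symbols that have arrived. -/
theorem exists_history_eq_iff {𝒳 : Type*} [Nonempty 𝒳] (h : List (Option 𝒳)) :
    ∃ (b : ℕ → Bool) (n : ℕ) (xs : ℕ → 𝒳), ∀ a x,
      (history (mark a x) h.length = h ↔
        (∀ s < h.length, a (s + 1) = b s) ∧ ∀ i < n, x i = xs i) ∧
      ((∀ s < h.length, a (s + 1) = b s) → numArrivals a h.length = n) := by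
  induction h with
  | nil =>
    -- `xs` matters only below `n`, so its initial value is arbitrary.
    exact ⟨fun _ => false, 0, fun _ => Classical.arbitrary 𝒳, fun a x => by
      simp [history, numArrivals_zero]⟩
  | cons e h ih =>
    obtain ⟨b, n, xs, H⟩ := ih
    rcases e with _ | y
    · refine ⟨Function.update b h.length false, n, xs, fun a x => ⟨?_, ?_⟩⟩
      · rw [List.length_cons, forall_lt_succ_eq_update_iff (f := fun s => a (s + 1)), history,
          List.cons.injEq, (H a x).1, mark]
        cases a (h.length + 1) <;> simp
      · rw [List.length_cons, forall_lt_succ_eq_update_iff (f := fun s => a (s + 1))]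
        rintro ⟨h1, h2⟩
        rw [numArrivals_succ, (H a x).2 h1, if_neg (by simp [Arrival, h2]), add_zero]
    · refine ⟨Function.update b h.length true, n + 1, Function.update xs n y,
        fun a x => ⟨?_, ?_⟩⟩
      · rw [List.length_cons, forall_lt_succ_eq_update_iff (f := fun s => a (s + 1)),
          forall_lt_succ_eq_update_iff (f := x), history,
          List.cons.injEq, (H a x).1, mark]
        cases h1 : a (h.length + 1)
        · simp
        · simp only [if_true, Option.some.injEq, and_true]
          constructor
          · rintro ⟨h2, h3, h4⟩
            exact ⟨h3, h4, (H a x).2 h3 ▸ h2⟩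
          · rintro ⟨h2, h3, h4⟩
            exact ⟨by rw [(H a x).2 h2]; exact h4, h2, h3⟩
      · rw [List.length_cons, forall_lt_succ_eq_update_iff (f := fun s => a (s + 1))]
        rintro ⟨h1, h2⟩
        rw [numArrivals_succ, (H a x).2 h1, if_pos (by simp [Arrival, h2])]

/-- The joint law is the product of the law of `f` with `ν`; taking the second marginal identifies
`ν` as the law of `g`. -/
theorem indepFun_of_measure_singleton {Ω A B : Type*} [MeasurableSpace Ω] {μ : Measure Ω}
    [IsProbabilityMeasure μ] [MeasurableSpace A] [MeasurableSpace B] [Countable A] [Countable B]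
    [MeasurableSingletonClass A] [MeasurableSingletonClass B] {f : Ω → A} {g : Ω → B}
    (hf : Measurable f) (hg : Measurable g) {ν : Measure B} [SFinite ν]
    (h : ∀ a b, μ {ω | f ω = a ∧ g ω = b} = μ {ω | f ω = a} * ν {b}) :
    IndepFun f g μ ∧ μ.map g = ν := by
  have hprod : μ.map (fun ω => (f ω, g ω)) = (μ.map f).prod ν := by
    refine Measure.ext_of_singleton fun ⟨a, b⟩ => ?_
    rw [Measure.map_apply (hf.prodMk hg) (measurableSet_singleton _),
      ← Set.singleton_prod_singleton, Measure.prod_prod, Measure.map_apply hf (measurableSet_singleton a)]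
    exact h a b
  have : IsProbabilityMeasure (μ.map f) := Measure.isProbabilityMeasure_map hf.aemeasurable
  have hsnd : μ.map g = ν := by
    have := congrArg Measure.snd hprod
    rwa [Measure.snd_map_prodMk hf, Measure.snd_prod] at this
  exact ⟨(indepFun_iff_map_prod_eq_prod_map_map hf.aemeasurable hg.aemeasurable).2
    (by rw [hprod, hsnd]), hsnd⟩

variable {Ω : Type*} [MeasurableSpace Ω] {μ : Measure Ω} [IsProbabilityMeasure μ]
  {𝒳 : Type*} [MeasurableSpace 𝒳] [MeasurableSingletonClass 𝒳]
  {q : ℝ} {P : PMF 𝒳} {active : ℕ → Ω → Bool} {X : ℕ → Ω → 𝒳}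

theorem measure_cylinder (hactive : ∀ t, Measurable (active t))
    (hactive_law : ∀ t, μ.real {ω | active t ω = true} = q)
    (hactive_indep : iIndepFun active μ)
    (hX_law : ∀ k x, μ {ω | X k ω = x} = P x) (hX_indep : iIndepFun X μ)
    (hindep : IndepFun (fun ω t => active t ω) (fun ω k => X k ω) μ)
    (b : ℕ → Bool) (xs : ℕ → 𝒳) (t n : ℕ) :
    μ {ω | (∀ s < t, active (s + 1) ω = b s) ∧ ∀ i < n, X i ω = xs i} =
      (∏ s ∈ Finset.range t, ENNReal.ofReal (if b s then q else 1 - q)) *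
        ∏ i ∈ Finset.range n, P (xs i) := by
  have hlaw : ∀ t v, μ {ω | active t ω = v} = ENNReal.ofReal (if v = true then q else 1 - q) := by
    intro t v
    have htrue : MeasurableSet {ω | active t ω = true} := hactive t (measurableSet_singleton true)
    rcases v with _ | _
    · have : {ω | active t ω = false} = {ω | active t ω = true}ᶜ := by ext ω; simp
      rw [this, ← ofReal_measureReal, probReal_compl_eq_one_sub htrue, hactive_law]
      simp
    · rw [← ofReal_measureReal, hactive_law]; simp
  have h1 := hindep.measure_inter_preimage_eq_mul
    (⋂ s ∈ Finset.range t, (fun a : ℕ → Bool => a (s + 1)) ⁻¹' {b s})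
    (⋂ i ∈ Finset.range n, (fun x : ℕ → 𝒳 => x i) ⁻¹' {xs i})
    (Finset.measurableSet_biInter _ fun s _ =>
      measurable_pi_apply (s + 1) (measurableSet_singleton (b s)))
    (Finset.measurableSet_biInter _ fun i _ =>
      measurable_pi_apply i (measurableSet_singleton (xs i)))
  -- Slots start at `1`, so the arrival indicators are reindexed by the successor.
  have h2 := (iIndepFun_iff_measure_inter_preimage_eq_mul.1
    (hactive_indep.precomp (Nat.succ_injective))) (Finset.range t) (sets := fun s => {b s})
    fun _ _ => measurableSet_singleton _
  have h3 := (iIndepFun_iff_measure_inter_preimage_eq_mul.1 hX_indep) (Finset.range n)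
    (sets := fun i => {xs i}) fun _ _ => measurableSet_singleton _
  calc _ = _ := by
        refine Eq.trans ?_ h1
        congr 1
        ext ω; simp
    _ = _ := by
        congr 1
        · refine Eq.trans ?_ (h2.trans (Finset.prod_congr rfl fun s _ => hlaw (s + 1) (b s)))
          congr 1
          ext ω; simp
        · refine Eq.trans ?_ (h3.trans (Finset.prod_congr rfl fun i _ => hX_law i (xs i)))
          congr 1
          ext ω; simp

/-- A given history is a cylinder event that fixes the number `n` of past arrivals. The next mark
therefore concerns the deterministic index `n`, and adds one factor for the slot and, if there is an
arrival, one for symbol `n`. -/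
theorem measure_history_mark (hq0 : 0 < q)
    (hactive : ∀ t, Measurable (active t))
    (hactive_law : ∀ t, μ.real {ω | active t ω = true} = q)
    (hactive_indep : iIndepFun active μ)
    (hX_law : ∀ k x, μ {ω | X k ω = x} = P x) (hX_indep : iIndepFun X μ)
    (hindep : IndepFun (fun ω t => active t ω) (fun ω k => X k ω) μ)
    (t : ℕ) (h : List (Option 𝒳)) (e : Option 𝒳) :
    μ {ω | history (mark (active · ω) (X · ω)) t = h ∧ mark (active · ω) (X · ω) t = e} =
      μ {ω | history (mark (active · ω) (X · ω)) t = h} * ENNReal.ofReal (markLaw q P e) := by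
  by_cases hlen : h.length = t
  swap
  · have hne : ∀ ω, history (mark (active · ω) (X · ω)) t ≠ h := fun ω hω =>
      hlen (by rw [← hω, length_history])
    simp [hne]
  subst hlen
  have : Nonempty 𝒳 := P.support_nonempty.to_type
  obtain ⟨b, n, xs, H⟩ := exists_history_eq_iff h
  have hcyl := measure_cylinder hactive hactive_law hactive_indep hX_law hX_indep hindep
  have h0 : μ {ω | history (mark (active · ω) (X · ω)) h.length = h} =
      (∏ s ∈ Finset.range h.length, ENNReal.ofReal (if b s then q else 1 - q)) *
        ∏ i ∈ Finset.range n, P (xs i) := by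
    simp_rw [(H _ _).1]
    exact hcyl b xs h.length n
  rw [h0]
  rcases e with _ | y
  · have h1 := hcyl (Function.update b h.length false) xs (h.length + 1) n
    rw [prod_range_succ_update (fun v => ENNReal.ofReal (if v = true then q else 1 - q))] at h1
    rw [show ∀ a b c : ENNReal, a * b * c = a * c * b from fun a b c => by ring]
    refine Eq.trans ?_ h1
    congr 1
    ext ω
    simp only [Set.mem_ofPred_eq, (H _ _).1,
      forall_lt_succ_eq_update_iff (f := fun s => active (s + 1) ω), mark]
    cases active (h.length + 1) ω <;> simp
  · have h1 := hcyl (Function.update b h.length true) (Function.update xs n y)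
      (h.length + 1) (n + 1)
    rw [prod_range_succ_update (fun v => ENNReal.ofReal (if v = true then q else 1 - q)),
      prod_range_succ_update P, if_pos rfl] at h1
    rw [markLaw, ENNReal.ofReal_mul hq0.le, ENNReal.ofReal_toReal (P.apply_ne_top y),
      show ∀ a b c d : ENNReal, a * b * (c * d) = a * c * (b * d) from fun a b c d => by ring]
    refine Eq.trans ?_ h1
    congr 1
    ext ω
    simp only [Set.mem_ofPred_eq, (H _ _).1,
      forall_lt_succ_eq_update_iff (f := fun s => active (s + 1) ω),
      forall_lt_succ_eq_update_iff (f := (X · ω)), mark]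
    have hn := (H (active · ω) (X · ω)).2
    cases active (h.length + 1) ω
    · simp
    · simp only [if_true, Option.some.injEq, and_true]
      constructor
      · rintro ⟨⟨h2, h3⟩, h4⟩
        exact ⟨h2, h3, hn h2 ▸ h4⟩
      · rintro ⟨h2, h3, h4⟩
        exact ⟨⟨h2, h3⟩, by rw [hn h2]; exact h4⟩

theorem measurableSet_mark_eq (hactive : ∀ t, Measurable (active t)) (hX : ∀ k, Measurable (X k))
    (t : ℕ) (e : Option 𝒳) : MeasurableSet {ω | mark (active · ω) (X · ω) t = e} := by
  have hN : ∀ t, Measurable fun ω => numArrivals (active · ω) t := by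
    intro t
    induction t with
    | zero => simp only [numArrivals_zero]; exact measurable_const
    | succ t ih =>
      simp only [numArrivals_succ, arrival_succ_iff]
      exact ih.add (Measurable.ite ((hactive (t + 1)) (measurableSet_singleton true))
        measurable_const measurable_const)
  have htrue : MeasurableSet {ω | active (t + 1) ω = true} :=
    hactive (t + 1) (measurableSet_singleton true)
  rcases e with _ | y
  · convert htrue.compl using 1
    ext ω; simp [mark]
  -- The random symbol index is resolved by a countable union over its values.
  · have : {ω | mark (active · ω) (X · ω) t = some y} = {ω | active (t + 1) ω = true} ∩
        ⋃ n, ({ω | numArrivals (active · ω) t = n} ∩ {ω | X n ω = y}) := by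
      ext ω; simp [mark]
    rw [this]
    exact htrue.inter (MeasurableSet.iUnion fun n =>
      ((hN t) (measurableSet_singleton n)).inter ((hX n) (measurableSet_singleton y)))

end Marks

/-! ### Long-run rates of the coding system and conclusion. -/

/-- The empty word is a prefix of every codeword, so it can only be the codeword of a one-letter
alphabet. -/
theorem PrefixFree.eq_nil_or_ne_nil {𝒳 : Type*} {c : 𝒳 → List Bool} (hc : PrefixFree c) :
    (∀ y, c y = []) ∨ ∀ y, c y ≠ [] := by
  by_contra! h
  obtain ⟨⟨y, hy⟩, z, hz⟩ := h
  exact hy (hc z y (hz ▸ List.nil_prefix) ▸ hz)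

theorem markLaw_nonneg {𝒳 : Type*} {q : ℝ} (hq0 : 0 < q) (hq1 : q ≤ 1) (P : PMF 𝒳) :
    ∀ e, 0 ≤ markLaw q P e
  | none => by simpa [markLaw] using hq1
  | some y => mul_nonneg hq0.le ENNReal.toReal_nonneg

/-- The long-run rates of arrivals and of the buffer lengths found at the arrival times. -/
theorem ae_tendsto_rates {Ω : Type*} [MeasurableSpace Ω] {μ : Measure Ω} [IsProbabilityMeasure μ]
    {𝒳 : Type*} [Fintype 𝒳] [MeasurableSpace 𝒳] [MeasurableSingletonClass 𝒳]
    {q : ℝ} (hq0 : 0 < q) (hq1 : q ≤ 1) {P : PMF 𝒳} {c : 𝒳 → List Bool}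
    {active : ℕ → Ω → Bool} (hactive : ∀ t, Measurable (active t))
    (hactive_law : ∀ t, μ.real {ω | active t ω = true} = q)
    (hactive_indep : iIndepFun active μ) {X : ℕ → Ω → 𝒳} (hX : ∀ k, Measurable (X k))
    (hX_law : ∀ k x, μ {ω | X k ω = x} = P x) (hX_indep : iIndepFun X μ)
    (hindep : IndepFun (fun ω t => active t ω) (fun ω k => X k ω) μ)
    (hstable : lengthMoment P c 1 < 1 / q) :
    ∀ᵐ ω ∂μ,
      Tendsto (fun T : ℕ => (numArrivals (active · ω) T : ℝ) / T) atTop (𝓝 q) ∧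
      Tendsto (fun T : ℕ => (∑ t ∈ Finset.range T, if Arrival (active · ω) (t + 1) then
        ((buffer c (active · ω) (X · ω) (t + 1)).length : ℝ) else 0) / T) atTop
        (𝓝 (q * (lengthMoment P c 2 - lengthMoment P c 1) /
          (2 * (1 - q * lengthMoment P c 1)) * q + q * lengthMoment P c 1)) := by
  let _ : MeasurableSpace (Option 𝒳) := ⊤
  let _ : MeasurableSpace (List (Option 𝒳)) := ⊤
  have : DiscreteMeasurableSpace (Option 𝒳) := ⟨fun _ => trivial⟩
  have : DiscreteMeasurableSpace (List (Option 𝒳)) := ⟨fun _ => trivial⟩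
  set Y : ℕ → Ω → Option 𝒳 := fun t ω => mark (active · ω) (X · ω) t with hYdef
  have hY : ∀ t, Measurable (Y t) := fun t =>
    measurable_to_countable' fun e => measurableSet_mark_eq hactive hX t e
  have hπ0 := markLaw_nonneg hq0 hq1 P
  let ν : Measure (Option 𝒳) :=
    Measure.sum fun e => ENNReal.ofReal (markLaw q P e) • Measure.dirac e
  have hν : ∀ e, ν {e} = ENNReal.ofReal (markLaw q P e) := fun e =>
    Measure.sum_smul_dirac_singleton
  have hind := fun t => indepFun_of_measure_singleton (μ := μ) (ν := ν)
    (measurable_history hY t) (hY t) fun h e => by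
      rw [hν]
      exact measure_history_mark hq0 hactive hactive_law hactive_indep hX_law hX_indep hindep t h e
  have hlaw : ∀ t (f : Option 𝒳 → ℝ), ∫ ω, f (Y t ω) ∂μ = ∑ e, markLaw q P e * f e := by
    intro t f
    -- `ν` inherits total mass one from being the law of a mark.
    have hνprob : IsProbabilityMeasure ν :=
      (hind t).2 ▸ Measure.isProbabilityMeasure_map (hY t).aemeasurable
    rw [← integral_map (hY t).aemeasurable Measurable.of_discrete.aestronglyMeasurable,
      (hind t).2, integral_fintype .of_finite]
    refine Finset.sum_congr rfl fun e _ => ?_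
    rw [Measure.real, hν, ENNReal.toReal_ofReal (hπ0 e), smul_eq_mul]
  have hm : ∑ e, markLaw q P e * (markLength c e : ℝ) = q * lengthMoment P c 1 := by
    rw [sum_markLaw_mul]; simp [markLength, lengthMoment]
  have hm2 : ∑ e, markLaw q P e * (markLength c e * ((markLength c e : ℝ) - 1)) =
      q * (lengthMoment P c 2 - lengthMoment P c 1) := by
    rw [sum_markLaw_mul, lengthMoment, lengthMoment, ← Finset.sum_sub_distrib]
    simp only [markLength, Nat.cast_zero, zero_mul, mul_zero, zero_add]
    congr 1
    exact Finset.sum_congr rfl fun y _ => by ring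
  have hsome : ∑ e, markLaw q P e * (if e.isSome then (1 : ℝ) else 0) = q := by
    have hP : ∑ y, (P y).toReal = 1 := by
      rw [← ENNReal.toReal_sum fun y _ => P.apply_ne_top y, ← tsum_fintype (L := .unconditional 𝒳),
        P.tsum_coe, ENNReal.toReal_one]
    rw [sum_markLaw_mul]; simp [hP]
  have hst : ∑ e, markLaw q P e * (markLength c e : ℝ) < 1 := by
    rw [hm, mul_comm]
    exact (lt_div_iff₀ hq0).1 hstable
  have h1 := ae_tendsto_average_mark hY (fun t => (hind t).1) hlaw
    fun e => if e.isSome then (1 : ℝ) else 0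
  have h2 := ae_tendsto_average_mark hY (fun t => (hind t).1) hlaw
    fun e => (markLength c e : ℝ)
  have h3 := ae_tendsto_average_backlog_mul hY (fun t => (hind t).1) hπ0 hlaw hst
    fun e => if e.isSome then (1 : ℝ) else 0
  rw [hsome] at h1
  rw [hm] at h2
  rw [hsome, hm, hm2] at h3
  filter_upwards [h1, h2, h3] with ω h1 h2 h3
  refine ⟨h1.congr fun T => ?_, (h3.add h2).congr fun T => ?_⟩
  · rw [numArrivals_eq_sum]
    congr 1
    refine Finset.sum_congr rfl fun t _ => ?_
    simp only [hYdef, mark, arrival_succ_iff]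
    split_ifs <;> simp_all
  · rw [← add_div, ← Finset.sum_add_distrib]
    congr 1
    refine Finset.sum_congr rfl fun t _ => ?_
    -- The buffer length at an arrival is the backlog found plus the new codeword; the latter needs
    -- no indicator, since an empty mark has length `0`.
    rw [length_buffer_succ_eq_mark, length_buffer_sub_one,
      show history (fun s => Y s ω) t = history (mark (active · ω) (X · ω)) t from rfl]
    generalize backlog (markLength c) _ = u
    simp only [hYdef, arrival_succ_iff]
    cases h : active (t + 1) ω <;> simp [mark, markLength, h]

end StreamCoding

theorem theorem1
    {Ω : Type*} [MeasurableSpace Ω] (μ : MeasureTheory.Measure Ω)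
    [MeasureTheory.IsProbabilityMeasure μ]
    {𝒳 : Type*} [Fintype 𝒳] [MeasurableSpace 𝒳] [MeasurableSingletonClass 𝒳]
    (q : ℝ) (hq0 : 0 < q) (hq1 : q ≤ 1)
    (P : PMF 𝒳) (c : 𝒳 → List Bool) (hc : StreamCoding.PrefixFree c)
    (Δ₀ : ℝ) (hΔ₀ : 0 ≤ Δ₀)
    -- the Bernoulli(q) arrival process
    (active : ℕ → Ω → Bool) (hactive : ∀ t, Measurable (active t))
    (hactive_law : ∀ t, μ.real {ω | active t ω = true} = q)
    (hactive_indep : ProbabilityTheory.iIndepFun active μ)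
    -- the i.i.d. source symbols
    (X : ℕ → Ω → 𝒳) (hX : ∀ k, Measurable (X k))
    (hX_law : ∀ k x, μ {ω | X k ω = x} = P x)
    (hX_indep : ProbabilityTheory.iIndepFun X μ)
    -- symbols and arrivals are independent
    (hindep : ProbabilityTheory.IndepFun (fun ω t => active t ω) (fun ω k => X k ω) μ)
    -- stability
    (hstable : StreamCoding.lengthMoment P c 1 < 1 / q) :
    ∀ᵐ ω ∂μ,
      {n : ℕ | StreamCoding.IsPeakTime Δ₀ c (fun t => active t ω) (fun k => X k ω) n}.Infinite ∧
      Filter.Tendsto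
        (fun K : ℕ => (1 / (K : ℝ)) * ∑ k ∈ Finset.range K,
          StreamCoding.peakAge Δ₀ c (fun t => active t ω) (fun k => X k ω) k)
        Filter.atTop
        (nhds ((StreamCoding.lengthMoment P c 2 - StreamCoding.lengthMoment P c 1) /
            (2 * (1 / q - StreamCoding.lengthMoment P c 1))
          + StreamCoding.lengthMoment P c 1 + 1 / q)) := by
  filter_upwards [StreamCoding.ae_tendsto_rates hq0 hq1 hactive hactive_law hactive_indep hX hX_law
    hX_indep hindep hstable] with ω hω
  have h := StreamCoding.tendsto_average_peakAge c (fun k => X k ω) Δ₀ hc.eq_nil_or_ne_nil hΔ₀ hq0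
    hω.1 hω.2
  refine ⟨h.1, ?_⟩
  -- What remains is the identity between `(g + 1) / q` and the stated value, where stability keeps
  -- `1 - q E[L]` nonzero.
  convert h.2 using 2
  have h1 : StreamCoding.lengthMoment P c 1 * q < 1 := (lt_div_iff₀ hq0).1 hstable
  have h2 : 1 - q * StreamCoding.lengthMoment P c 1 ≠ 0 := by linarith
  have h3 : 1 / q - StreamCoding.lengthMoment P c 1 =
      (1 - q * StreamCoding.lengthMoment P c 1) / q := by field_simp
  rw [h3]
  field_simp
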